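/- Let $\mathbb K\in\{\mathbb R,\mathbb C\}$, let $n,m$ be natural numbers, and let $\Phi=(\phi_i)_{i=1}^m$ be a frame for $\mathbb K^n$, i.e. there are $0<A\le B$ with $A\|x\|_2^2\le\sum_{i=1}^m|\langle x,\phi_i\rangle|^2\le B\|x\|_2^2$ for all $x\in\mathbb K^n$. (Then necessarily $m\ge n$.) Put $r=m-n$. A frame $\Psi=(\psi_i)_{i=1}^m$ for $\mathbb K^n$ is called a dual of $\Phi$ if $x=\sum_{i=1}^m\langle x,\phi_i\rangle\psi_i$ for all $x\in\mathbb K^n$. The singular values of a frame are the $n$ singular values, counted with multiplicity and in non-increasing order, of its synthesis operator $\mathbb K^m\to\mathbb K^n$, $c\mapsto\sum_{i=1}^m c_i\phi_i$ (equivalently, of the $n\times m$ matrix whose columns are the frame vectors). Let $\sigma_1\ge\dots\ge\sigma_n>0$ be the singular values of $\Phi$. (a) If $\Psi$ is any dual of $\Phi$, with singular values $\sigma_1^\Psi\ge\dots\ge\sigma_n^\Psi$, then $$\frac1{\sigma_{n-i+1}}\le\sigma_i^\Psi\quad\text{for } 1\le i\le\min\{r,n\},\qquad(1)$$ $$\frac1{\sigma_{n-i+1}}\le\sigma_i^\Psi\le\frac1{\sigma_{n-i+r+1}}\quad\text{for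 } r+1\le i\le n.\qquad(2)$$ (b) Conversely, for every non-increasing sequence of real numbers $(\sigma_i^\Psi)_{i=1}^n$ that satisfies (1) and (2), there is a dual $\Psi$ of $\Phi$ whose singular values are $\sigma_1^\Psi,\dots,\sigma_n^\Psi$. -/

import Mathlib

/-- A finite family `φ` of vectors of a Hilbert space `H` is a frame for `H` if there are bounds
`0 < A ≤ B` with `A ‖x‖² ≤ ∑ i, |⟨x, φ i⟩|² ≤ B ‖x‖²` for all `x`. -/
def IsFrame (𝕜 : Type*) [RCLike 𝕜] {H : Type*} [NormedAddCommGroup H] [InnerProductSpace 𝕜 H]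
    {m : ℕ} (φ : Fin m → H) : Prop :=
  ∃ A B : ℝ, 0 < A ∧ A ≤ B ∧ ∀ x : H,
    A * ‖x‖ ^ 2 ≤ ∑ i, ‖inner 𝕜 (φ i) x‖ ^ 2 ∧ ∑ i, ‖inner 𝕜 (φ i) x‖ ^ 2 ≤ B * ‖x‖ ^ 2

/-- `ψ` is a dual frame of `φ`: it is a frame and `x = ∑ i, ⟨x, φ i⟩ ψ i` for all `x`.
(The inner product `⟨x, y⟩` that is linear in `x` is `inner 𝕜 y x`.) -/
def IsDualFrame (𝕜 : Type*) [RCLike 𝕜] {H : Type*} [NormedAddCommGroup H]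
    [InnerProductSpace 𝕜 H] {m : ℕ} (φ ψ : Fin m → H) : Prop :=
  IsFrame 𝕜 ψ ∧ ∀ x : H, x = ∑ i, inner 𝕜 (φ i) x • ψ i

/-- The synthesis operator `c ↦ ∑ i, c i • φ i` of a finite family of vectors, defined on `𝕜ᵐ` with
the Euclidean inner product. For `H = 𝕜ⁿ` its matrix is the `n × m` matrix with columns `φ i`. -/
noncomputable def synthesisOperator (𝕜 : Type*) [RCLike 𝕜] {H : Type*} [NormedAddCommGroup H]
    [InnerProductSpace 𝕜 H] {m : ℕ} (φ : Fin m → H) : EuclideanSpace 𝕜 (Fin m) →ₗ[𝕜] H where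
  toFun c := ∑ i, c i • φ i
  map_add' c d := by simp [add_smul, Finset.sum_add_distrib]
  map_smul' a c := by simp [mul_smul, Finset.smul_sum]

/-- The `k`-th largest singular value `σ_k`, `k = 1, 2, …`, of (the synthesis operator of) a finite
family of vectors, counted with multiplicity. Mathlib numbers singular values from `0`, whence
the shift; the value at `k = 0` is not used. -/
noncomputable def frameSingularValue (𝕜 : Type*) [RCLike 𝕜] {H : Type*} [NormedAddCommGroup H]
    [InnerProductSpace 𝕜 H] [FiniteDimensional 𝕜 H] {m : ℕ} (φ : Fin m → H) (k : ℕ) : ℝ :=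
  (synthesisOperator 𝕜 φ).singularValues (k - 1)

/-! Let `A` be the adjoint of the synthesis operator of Φ. Duals of Φ are exactly the left inverses
`U` of `A`, and their frame property is automatic. For (a), `A` shrinks or stretches suitable
subspaces by at most or at least a given singular value; `U` undoes this on their images, and
Courant–Fischer bounds the singular values of `U`. For (b), put `R = (A* A)⁻¹`. The adjoints of left
inverses are the maps `A R + C` with `C` valued in the `r`-dimensional space `(range A)ᗮ`, and `(A R
+ C)* (A R + C) = R + C* C`. Here `C* C` can be any positive operator of rank at most `r`, so what
is needed is a converse to eigenvalue interlacing. In rank one, the squared coordinates of the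
perturbing vector are residues of a quotient of characteristic polynomials; rank `r` follows by
induction. -/

/-! ### Positive perturbations with prescribed spectrum -/

/-- Partial fractions for interlacing sequences: if `μ 0 ≤ l 0` and `μ i ≤ l i ≤ μ (i - 1)`, then
`∏ (z - l i) / ∏ (z - μ i) = 1 - ∑ c i / (z - μ i)` with nonnegative residues `c i`. -/
theorem exists_nonneg_residues {𝕜 : Type*} [RCLike 𝕜] {μ l : ℕ → ℝ} (hμ : Antitone μ)
    (h1 : ∀ i, μ i ≤ l i) (h2 : ∀ i, l (i + 1) ≤ μ i) (n : ℕ) :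
    ∃ c : ℕ → ℝ, (∀ i, 0 ≤ c i) ∧ ∀ z : 𝕜, (∀ i < n, z ≠ μ i) →
      ∏ i ∈ Finset.range n, (z - l i) =
        (∏ i ∈ Finset.range n, (z - μ i)) * (1 - ∑ i ∈ Finset.range n, c i / (z - μ i)) := by
  induction n with
  | zero => exact ⟨0, by simp, by simp⟩
  | succ n ih =>
    obtain ⟨c, hc, h⟩ := ih
    have key : ∀ i < n, l n ≤ μ i := fun i hi => by
      obtain ⟨k, rfl⟩ : ∃ k, n = k + 1 := ⟨n - 1, by omega⟩
      exact (h2 k).trans (hμ (by omega))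
    -- The new factor splits as `(z - l n) / ((z - μ i) (z - μ n)) = (1 - w i) / (z - μ i) + w i /
    -- (z - μ n)`, and interlacing puts `w i` in `[0, 1]`. If `μ i = μ n`, then `l n = μ n` too, and
    -- the junk value `w i = 0` is right.
    set w : ℕ → ℝ := fun i => (l n - μ n) / (μ i - μ n) with hw
    have hw0 : ∀ i < n, 0 ≤ w i := fun i hi =>
      div_nonneg (sub_nonneg.2 (h1 n)) (sub_nonneg.2 ((h1 n).trans (key i hi)))
    have hw1 : ∀ i < n, w i ≤ 1 := fun i hi =>
      div_le_one_of_le₀ (by linarith [key i hi]) (sub_nonneg.2 ((h1 n).trans (key i hi)))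
    have hw2 : ∀ i < n, w i * (μ i - μ n) = l n - μ n := fun i hi => by
      by_cases e : μ i - μ n = 0
      · have := key i hi
        have := h1 n
        rw [e, mul_zero]; linarith
      · exact div_mul_cancel₀ _ e
    refine ⟨fun i => if i < n then c i * (1 - w i) else if i = n then
      (l n - μ n) + ∑ j ∈ Finset.range n, c j * w j else 0, fun i => ?_, fun z hz => ?_⟩
    · dsimp only
      split_ifs with hi hi'
      · exact mul_nonneg (hc i) (by linarith [hw1 i hi])
      · exact add_nonneg (sub_nonneg.2 (h1 n)) (Finset.sum_nonneg fun j hj =>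
          mul_nonneg (hc j) (hw0 j (Finset.mem_range.1 hj)))
      · exact le_rfl
    · rw [Finset.prod_range_succ, Finset.prod_range_succ, h z fun i hi => hz i (by omega),
        Finset.sum_range_succ, mul_assoc, mul_assoc]
      congr 1
      have hzn : z - μ n ≠ 0 := sub_ne_zero.2 (hz n (by omega))
      simp only [lt_irrefl, if_false, if_true]
      have e : ∀ i ∈ Finset.range n,
          ((if i < n then c i * (1 - w i) else if i = n then
            (l n - μ n) + ∑ j ∈ Finset.range n, c j * w j else 0 : ℝ) : 𝕜) / (z - μ i) * (z - μ n)
            = (c i / (z - μ i)) * (z - l n) - ((c i * w i : ℝ) : 𝕜) := fun i hi => by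
        have hi := Finset.mem_range.1 hi
        have hzi : z - μ i ≠ 0 := sub_ne_zero.2 (hz i (by omega))
        have h3 : (w i : 𝕜) * (μ i - μ n) = l n - μ n := by exact_mod_cast hw2 i hi
        rw [if_pos hi]
        field_simp
        push_cast
        linear_combination (-(c i : 𝕜)) * h3
      have e2 := Finset.sum_congr rfl e
      rw [← Finset.sum_mul, Finset.sum_sub_distrib, ← Finset.sum_mul, ← RCLike.ofReal_sum] at e2
      have e3 : ((l n - μ n + ∑ j ∈ Finset.range n, c j * w j : ℝ) : 𝕜) / (z - μ n) * (z - μ n)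
          = l n - μ n + ((∑ j ∈ Finset.range n, c j * w j : ℝ) : 𝕜) := by
        rw [div_mul_cancel₀ _ hzn]; push_cast; ring
      linear_combination e2 + e3

open Matrix in
/-- The matrix determinant lemma for a rank one update of a diagonal matrix. -/
theorem Matrix.det_diagonal_sub_vecMulVec {ι K : Type*} [Fintype ι] [DecidableEq ι] [Field K]
    {d : ι → K} (hd : ∀ i, d i ≠ 0) (u v : ι → K) :
    (diagonal d - vecMulVec u v).det = (∏ i, d i) * (1 - ∑ i, u i * v i / d i) := by
  have hA : IsUnit (diagonal d).det := by
    rw [det_diagonal]; exact (Finset.prod_ne_zero_iff.2 fun i _ => hd i).isUnit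
  have h := det_add_replicateCol_mul_replicateRow (ι := Unit) hA (-u) v
  rw [← vecMulVec_eq, neg_vecMulVec, ← sub_eq_add_neg, det_diagonal] at h
  have e : (diagonal d)⁻¹ = diagonal fun i => (d i)⁻¹ := by
    refine inv_eq_right_inv ?_
    rw [diagonal_mul_diagonal, ← diagonal_one]
    exact congrArg _ (funext fun i => mul_inv_cancel₀ (hd i))
  rw [h, e, det_unique]
  congr 1
  rw [add_apply, one_apply_eq, mul_apply, sub_eq_add_neg, ← Finset.sum_neg_distrib]
  congr 1
  refine Finset.sum_congr rfl fun i _ => ?_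
  rw [mul_diagonal, replicateRow_apply, replicateCol_apply, Pi.neg_apply, div_eq_mul_inv]
  ring

open Polynomial in
/-- A symmetric operator whose characteristic polynomial has the roots `l 0 ≥ l 1 ≥ …` has the
sorted eigenvalues `l 0, l 1, …`. -/
theorem LinearMap.IsSymmetric.eigenvalues_eq_of_charpoly {𝕜 E : Type*} [RCLike 𝕜]
    [NormedAddCommGroup E] [InnerProductSpace 𝕜 E] [FiniteDimensional 𝕜 E] {n : ℕ}
    {S : E →ₗ[𝕜] E} (hS : S.IsSymmetric) (hn : Module.finrank 𝕜 E = n) {l : ℕ → ℝ}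
    (hl : Antitone l) (h : S.charpoly = ∏ i ∈ Finset.range n, (X - C (l i : 𝕜))) (i : Fin n) :
    hS.eigenvalues hn i = l i := by
  have h1 := hS.sort_roots_charpoly_eq_eigenvalues hn
  have h2 : S.charpoly.roots = Multiset.ofList (List.ofFn fun i : Fin n => (l i : 𝕜)) := by
    rw [h, ← Fin.prod_univ_eq_prod_range (fun i => X - C (l i : 𝕜)),
      Polynomial.roots_prod _ _ (Finset.prod_ne_zero_iff.2 fun i _ => X_sub_C_ne_zero _)]
    simp [Multiset.bind_singleton]
  rw [h2] at h1
  have h3 : List.ofFn (fun i : Fin n => l i) = List.ofFn (hS.eigenvalues hn) := by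
    refine List.Perm.eq_of_sortedGE ?_ ?_ ?_
    · exact (hl.comp_monotone Fin.val_strictMono.monotone).sortedGE_ofFn
    · exact (hS.eigenvalues_antitone hn).sortedGE_ofFn
    · rw [← h1, ← Multiset.coe_eq_coe, Multiset.sort_eq]
      simp [List.map_ofFn, Function.comp_def]
  exact (congrFun (List.ofFn_inj.1 h3) i).symm

open Polynomial InnerProductSpace in
/-- Converse of the interlacing theorem for positive rank one perturbations. -/
theorem LinearMap.IsSymmetric.exists_charpoly_add_rankOne {𝕜 E : Type*} [RCLike 𝕜]
    [NormedAddCommGroup E] [InnerProductSpace 𝕜 E] [FiniteDimensional 𝕜 E] {n : ℕ}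
    {S : E →ₗ[𝕜] E} (hS : S.IsSymmetric) (hn : Module.finrank 𝕜 E = n) {μ l : ℕ → ℝ}
    (hμ : Antitone μ) (h1 : ∀ i, μ i ≤ l i) (h2 : ∀ i, l (i + 1) ≤ μ i)
    (hSμ : S.charpoly = ∏ i ∈ Finset.range n, (X - C (μ i : 𝕜))) :
    ∃ x : E, (S + (rankOne 𝕜 x x).toLinearMap).charpoly =
      ∏ i ∈ Finset.range n, (X - C (l i : 𝕜)) := by
  obtain ⟨c, hc, h⟩ := exists_nonneg_residues (𝕜 := 𝕜) hμ h1 h2 n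
  let b := hS.eigenvectorBasis hn
  -- With squared coordinates `c i`, the determinant lemma produces exactly the partial fraction
  -- sum.
  let x : E := ∑ i : Fin n, ((√(c i) : ℝ) : 𝕜) • b i
  have hx : ∀ i, inner 𝕜 (b i) x = ((√(c i) : ℝ) : 𝕜) :=
    fun i => b.orthonormal.inner_right_fintype _ i
  refine ⟨x, ?_⟩
  have hM : LinearMap.toMatrix b.toBasis b.toBasis (S + (rankOne 𝕜 x x).toLinearMap) =
      Matrix.diagonal (fun i : Fin n => (μ i : 𝕜)) +
        Matrix.vecMulVec (fun i : Fin n => ((√(c i) : ℝ) : 𝕜))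
          (fun i : Fin n => ((√(c i) : ℝ) : 𝕜)) := by
    ext i j
    have e : S (b j) = (μ j : 𝕜) • b j := by
      rw [← hS.eigenvalues_eq_of_charpoly hn hμ hSμ j]
      exact hS.apply_eigenvectorBasis hn j
    have hx' : inner 𝕜 x (b j) = ((√(c j) : ℝ) : 𝕜) := by
      rw [← inner_conj_symm, hx, RCLike.conj_ofReal]
    simp only [LinearMap.toMatrix_apply, LinearMap.add_apply, OrthonormalBasis.coe_toBasis, e,
      OrthonormalBasis.coe_toBasis_repr_apply, OrthonormalBasis.repr_apply_apply, inner_add_right,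
      ContinuousLinearMap.coe_coe, rankOne_apply, inner_smul_right, hx, hx', Matrix.add_apply,
      Matrix.vecMulVec_apply, Matrix.diagonal_apply, orthonormal_iff_ite.1 b.orthonormal i j]
    rw [mul_comm ((√(c j) : ℝ) : 𝕜)]
    split_ifs with hij <;> simp [hij]
  rw [← LinearMap.charpoly_toMatrix _ b.toBasis, hM]
  -- Both formulas need `z` away from every `μ i`; agreement off a finite set suffices.
  refine Polynomial.eq_of_infinite_eval_eq _ _ (Set.Infinite.mono
    (s := ((Finset.range n).image fun i => (μ i : 𝕜))ᶜ) ?_ (Set.Finite.infinite_compl (Finset.finite_toSet _)))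
  intro z hz
  have hz : ∀ i < n, z ≠ μ i := by
    intro i hi e
    exact hz (by simp only [Finset.coe_image, Set.mem_image]; exact ⟨i, by simpa using hi, e.symm⟩)
  simp only [Set.mem_ofPred_eq, Matrix.eval_charpoly, eval_prod, eval_sub, eval_X, eval_C]
  rw [h z hz, ← sub_sub, Matrix.scalar_apply, Matrix.diagonal_sub,
    Matrix.det_diagonal_sub_vecMulVec (fun i : Fin n => sub_ne_zero.2 (hz i i.2)),
    ← Fin.prod_univ_eq_prod_range (fun i => z - (μ i : 𝕜)),
    ← Fin.sum_univ_eq_sum_range (fun i => (c i : 𝕜) / (z - μ i))]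
  congr 2
  refine Finset.sum_congr rfl fun i _ => ?_
  rw [← RCLike.ofReal_mul, Real.mul_self_sqrt (hc i)]

open Polynomial InnerProductSpace in
/-- Converse of the interlacing theorem for positive perturbations of rank at most `r`. -/
theorem LinearMap.IsSymmetric.exists_charpoly_add_sum_rankOne {𝕜 E : Type*} [RCLike 𝕜]
    [NormedAddCommGroup E] [InnerProductSpace 𝕜 E] [FiniteDimensional 𝕜 E] {n : ℕ}
    (hn : Module.finrank 𝕜 E = n) (r : ℕ) {S : E →ₗ[𝕜] E} (hS : S.IsSymmetric) {μ l : ℕ → ℝ}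
    (hμ : Antitone μ) (hl : Antitone l) (h1 : ∀ i, μ i ≤ l i) (h2 : ∀ i, l (i + r) ≤ μ i)
    (hSμ : S.charpoly = ∏ i ∈ Finset.range n, (X - C (μ i : 𝕜))) :
    ∃ x : Fin r → E, (S + ∑ j, (rankOne 𝕜 (x j) (x j)).toLinearMap).charpoly =
      ∏ i ∈ Finset.range n, (X - C (l i : 𝕜)) := by
  induction r generalizing S μ with
  | zero =>
    obtain rfl : μ = l := funext fun i => le_antisymm (h1 i) (h2 i)
    exact ⟨Fin.elim0, by simpa using hSμ⟩
  | succ r ih =>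
    -- One rank one step must reach a sequence lying between `l (i + r)` and `l i` and interlacing
    -- with `μ`; the maximum is the smallest candidate.
    obtain ⟨y, hy⟩ := hS.exists_charpoly_add_rankOne hn (l := fun i => max (μ i) (l (i + r)))
      hμ (fun i => le_max_left _ _) (fun i => max_le (hμ (by omega))
        ((hl (by omega)).trans (h2 i))) hSμ
    obtain ⟨x, hx⟩ := ih (hS.add (isSymmetric_rankOne_self y))
      (μ := fun i => max (μ i) (l (i + r)))
      (fun i j hij => max_le_max (hμ hij) (hl (by omega)))
      (fun i => max_le (h1 i) (hl (by omega))) (fun i => le_max_right _ _) hy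
    exact ⟨Fin.cons y x, by simpa [Fin.sum_univ_succ, add_assoc] using hx⟩

/-! ### Courant–Fischer bounds for singular values -/

section

open Module

variable {𝕜 : Type*} [RCLike 𝕜]
  {E : Type*} [NormedAddCommGroup E] [InnerProductSpace 𝕜 E]
  {F : Type*} [NormedAddCommGroup F] [InnerProductSpace 𝕜 F]

theorem OrthonormalBasis.inner_eq_zero_of_mem_span {ι κ : Type*} [Fintype ι]
    (b : OrthonormalBasis ι 𝕜 E) {f : κ → ι} {i : ι} (hi : ∀ k, f k ≠ i) {v : E}
    (hv : v ∈ Submodule.span 𝕜 (Set.range (b ∘ f))) : inner 𝕜 (b i) v = 0 := by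
  induction hv using Submodule.span_induction with
  | mem x hx =>
    obtain ⟨k, rfl⟩ := hx
    exact b.orthonormal.inner_eq_zero (hi k).symm
  | zero => exact inner_zero_right _
  | add x y _ _ hx hy => rw [inner_add_right, hx, hy, add_zero]
  | smul a x _ hx => rw [inner_smul_right, hx, mul_zero]

theorem OrthonormalBasis.finrank_span_comp {ι : Type*} [Fintype ι]
    (b : OrthonormalBasis ι 𝕜 E) {q : ℕ} {f : Fin q → ι} (hf : Function.Injective f) :
    finrank 𝕜 (Submodule.span 𝕜 (Set.range (b ∘ f))) = q := by
  rw [finrank_span_eq_card (b.orthonormal.comp f hf).linearIndependent, Fintype.card_fin]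

namespace LinearMap

theorem finrank_map_of_injOn {K V W : Type*} [DivisionRing K] [AddCommGroup V] [Module K V]
    [AddCommGroup W] [Module K W] {f : V →ₗ[K] W} {p : Submodule K V} (hf : Set.InjOn f p) :
    finrank K (p.map f) = finrank K p := by
  rw [← range_domRestrict]
  exact finrank_range_of_inj fun x y h => Subtype.ext (hf x.2 y.2 h)

variable [FiniteDimensional 𝕜 E] [FiniteDimensional 𝕜 F]

theorem norm_sq_apply_eq_sum_singularValues (T : E →ₗ[𝕜] F) (v : E) :
    ‖T v‖ ^ 2 = ∑ i : Fin (finrank 𝕜 E), T.singularValues i ^ 2 *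
      ‖inner 𝕜 (T.isSymmetric_adjoint_comp_self.eigenvectorBasis rfl i) v‖ ^ 2 := by
  have hS := T.isSymmetric_adjoint_comp_self
  have h : (‖T v‖ ^ 2 : ℝ) = RCLike.re (inner 𝕜 v ((adjoint T ∘ₗ T) v)) := by
    rw [comp_apply, adjoint_inner_right, ← norm_sq_eq_re_inner]
  rw [h, ← (hS.eigenvectorBasis rfl).sum_inner_mul_inner, map_sum]
  refine Finset.sum_congr rfl fun i _ => ?_
  rw [← hS, hS.apply_eigenvectorBasis, inner_smul_left, RCLike.conj_ofReal,
    T.sq_singularValues_fin rfl, mul_left_comm, RCLike.re_ofReal_mul, ← inner_conj_symm v,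
    RCLike.conj_mul]
  norm_cast

theorem exists_finrank_le_norm_apply (T : E →ₗ[𝕜] F) {k : ℕ} (hk : k < finrank 𝕜 E) :
    ∃ V : Submodule 𝕜 E, finrank 𝕜 V = k + 1 ∧ ∀ v ∈ V, T.singularValues k * ‖v‖ ≤ ‖T v‖ := by
  set b := T.isSymmetric_adjoint_comp_self.eigenvectorBasis rfl with hb
  -- `V` is spanned by the first `k + 1` right singular vectors.
  refine ⟨_, b.finrank_span_comp (Fin.castLE_injective (Nat.succ_le_of_lt hk)), fun v hv => ?_⟩
  refine le_of_sq_le_sq ?_ (norm_nonneg _)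
  rw [mul_pow, ← b.sum_sq_norm_inner_right v, T.norm_sq_apply_eq_sum_singularValues, Finset.mul_sum]
  refine Finset.sum_le_sum fun i _ => ?_
  by_cases hi : (i : ℕ) ≤ k
  · have h1 := T.singularValues_antitone hi
    have h2 := T.singularValues_nonneg k
    exact mul_le_mul_of_nonneg_right (pow_le_pow_left₀ h2 h1 2) (sq_nonneg _)
  · have : inner 𝕜 (b i) v = 0 := b.inner_eq_zero_of_mem_span
      (fun j hj => hi (by rw [← hj]; exact Nat.le_of_lt_succ j.2)) hv
    simp [← hb, this]

theorem exists_finrank_norm_apply_le (T : E →ₗ[𝕜] F) {k : ℕ} (hk : k ≤ finrank 𝕜 E) :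
    ∃ V : Submodule 𝕜 E, finrank 𝕜 V + k = finrank 𝕜 E ∧
      ∀ v ∈ V, ‖T v‖ ≤ T.singularValues k * ‖v‖ := by
  set b := T.isSymmetric_adjoint_comp_self.eigenvectorBasis rfl with hb
  let f : Fin (finrank 𝕜 E - k) → Fin (finrank 𝕜 E) := fun j => ⟨k + j, by omega⟩
  have hf : Function.Injective f := fun i j h => by
    simpa [f, Fin.ext_iff] using h
  refine ⟨_, ?_, fun v (hv : v ∈ Submodule.span 𝕜 (Set.range (b ∘ f))) => ?_⟩
  · rw [b.finrank_span_comp hf]; omega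
  refine le_of_sq_le_sq ?_ (mul_nonneg (T.singularValues_nonneg k) (norm_nonneg _))
  rw [mul_pow, ← b.sum_sq_norm_inner_right v, T.norm_sq_apply_eq_sum_singularValues, Finset.mul_sum]
  refine Finset.sum_le_sum fun i _ => ?_
  by_cases hi : k ≤ (i : ℕ)
  · have h1 := T.singularValues_antitone hi
    have h2 := T.singularValues_nonneg i
    exact mul_le_mul_of_nonneg_right (pow_le_pow_left₀ h2 h1 2) (sq_nonneg _)
  · have : inner 𝕜 (b i) v = 0 := b.inner_eq_zero_of_mem_span
      (fun j hj => hi (by rw [← hj]; simp [f])) hv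
    simp [← hb, this]

/-- By dimension count, `V` meets the span of the right singular vectors of index at least `k`,
which has codimension `k`. -/
theorem le_singularValues_of_finrank_lt (T : E →ₗ[𝕜] F) {k : ℕ} {V : Submodule 𝕜 E} {c : ℝ}
    (hV : k < finrank 𝕜 V) (h : ∀ v ∈ V, c * ‖v‖ ≤ ‖T v‖) : c ≤ T.singularValues k := by
  have hVE := V.finrank_le
  obtain ⟨W, hW, hWT⟩ := T.exists_finrank_norm_apply_le (k := k) (by omega)
  obtain ⟨v, hv, hv0⟩ : ∃ v ∈ V ⊓ W, v ≠ 0 := by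
    refine Submodule.exists_mem_ne_zero_of_ne_bot fun hVW => ?_
    have := Submodule.finrank_sup_add_finrank_inf_eq V W
    have := (V ⊔ W).finrank_le
    rw [hVW, finrank_bot] at *
    omega
  exact le_of_mul_le_mul_right ((h v hv.1).trans (hWT v hv.2)) (norm_pos_iff.2 hv0)

theorem singularValues_le_of_lt_finrank_add (T : E →ₗ[𝕜] F) {k : ℕ} {V : Submodule 𝕜 E} {c : ℝ}
    (hk : k < finrank 𝕜 E) (hV : finrank 𝕜 E ≤ finrank 𝕜 V + k) (h : ∀ v ∈ V, ‖T v‖ ≤ c * ‖v‖) :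
    T.singularValues k ≤ c := by
  obtain ⟨W, hW, hWT⟩ := T.exists_finrank_le_norm_apply hk
  obtain ⟨v, hv, hv0⟩ : ∃ v ∈ V ⊓ W, v ≠ 0 := by
    refine Submodule.exists_mem_ne_zero_of_ne_bot fun hVW => ?_
    have := Submodule.finrank_sup_add_finrank_inf_eq V W
    have := (V ⊔ W).finrank_le
    rw [hVW, finrank_bot] at *
    omega
  exact le_of_mul_le_mul_right ((hWT v hv.2).trans (h v hv.1)) (norm_pos_iff.2 hv0)

/-- If `T` stretches `V` by at least `σ`, then `‖T v‖² = ⟨T* T v, v⟩ ≤ ‖T* T v‖ ‖v‖` shows that `T*`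
stretches `T V` by at least `σ`. -/
theorem singularValues_le_adjoint (T : E →ₗ[𝕜] F) (k : ℕ) :
    T.singularValues k ≤ (adjoint T).singularValues k := by
  obtain h0 | hpos := (T.singularValues_nonneg k).eq_or_lt
  · exact h0 ▸ singularValues_nonneg _ k
  have hk : k < finrank 𝕜 E := not_le.1 fun h => hpos.ne' (T.singularValues_of_finrank_le h)
  obtain ⟨V, hV, hVT⟩ := T.exists_finrank_le_norm_apply hk
  have hinj : Set.InjOn T V := fun v hv w hw hvw => by
    have := hVT _ (V.sub_mem hv hw)
    rw [map_sub, hvw, sub_self, norm_zero] at this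
    rw [← sub_eq_zero, ← norm_le_zero_iff]
    exact nonpos_of_mul_nonpos_right this hpos
  refine le_singularValues_of_finrank_lt (V := V.map T) _ ?_ ?_
  · rw [finrank_map_of_injOn hinj, hV]
    exact k.lt_succ_self
  · rintro _ ⟨v, hv, rfl⟩
    obtain h | h := (norm_nonneg v).eq_or_lt
    · simp [norm_eq_zero.1 h.symm]
    refine le_of_mul_le_mul_right ?_ h
    calc T.singularValues k * ‖T v‖ * ‖v‖ = (T.singularValues k * ‖v‖) * ‖T v‖ := by ring
      _ ≤ ‖T v‖ * ‖T v‖ := by gcongr; exact hVT v hv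
      _ = ‖inner 𝕜 (adjoint T (T v)) v‖ := by
        rw [adjoint_inner_left, inner_self_eq_norm_sq_to_K, norm_pow, RCLike.norm_ofReal,
          abs_norm, sq]
      _ ≤ ‖adjoint T (T v)‖ * ‖v‖ := norm_inner_le_norm _ _

theorem singularValues_adjoint (T : E →ₗ[𝕜] F) (k : ℕ) :
    (adjoint T).singularValues k = T.singularValues k :=
  le_antisymm (by simpa using (adjoint T).singularValues_le_adjoint k)
    (T.singularValues_le_adjoint k)

/-- `A` stretches some `(k + 1)`-dimensional subspace by at most the singular value in question, so
`U` stretches its image by at least the inverse. -/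
theorem inv_singularValues_le_of_comp_eq_id {A : F →ₗ[𝕜] E} {U : E →ₗ[𝕜] F}
    (h : U ∘ₗ A = LinearMap.id) {k : ℕ} (hk : k < finrank 𝕜 F) :
    1 / A.singularValues (finrank 𝕜 F - 1 - k) ≤ U.singularValues k := by
  have hU : ∀ x, U (A x) = x := fun x => congr($h x)
  have hinj : Function.Injective A := Function.LeftInverse.injective hU
  obtain ⟨V, hV, hVA⟩ := A.exists_finrank_norm_apply_le (k := finrank 𝕜 F - 1 - k) (by omega)
  have hpos := A.injective_iff_forall_lt_finrank_singularValues_pos.1 hinj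
    (finrank 𝕜 F - 1 - k) (by omega)
  refine le_singularValues_of_finrank_lt (V := V.map A) _ ?_ ?_
  · rw [finrank_map_of_injOn hinj.injOn]; omega
  · rintro _ ⟨v, hv, rfl⟩
    rw [hU, one_div, inv_mul_le_iff₀ hpos]
    exact hVA v hv

/-- The image under `A` of the top `finrank 𝕜 F - k + r` singular directions has codimension `k` in
`E`; `r ≤ k` keeps the index of `A` below `finrank 𝕜 F`. -/
theorem singularValues_le_inv_of_comp_eq_id {A : F →ₗ[𝕜] E} {U : E →ₗ[𝕜] F}
    (h : U ∘ₗ A = LinearMap.id) {r k : ℕ} (hr : finrank 𝕜 E = finrank 𝕜 F + r)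
    (hk : k < finrank 𝕜 F) (hrk : r ≤ k) :
    U.singularValues k ≤ 1 / A.singularValues (finrank 𝕜 F - 1 - k + r) := by
  have hU : ∀ x, U (A x) = x := fun x => congr($h x)
  have hinj : Function.Injective A := Function.LeftInverse.injective hU
  obtain ⟨V, hV, hVA⟩ := A.exists_finrank_le_norm_apply (k := finrank 𝕜 F - 1 - k + r) (by omega)
  have hpos := A.injective_iff_forall_lt_finrank_singularValues_pos.1 hinj
    (finrank 𝕜 F - 1 - k + r) (by omega)
  refine singularValues_le_of_lt_finrank_add (V := V.map A) _ (by omega) ?_ ?_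
  · rw [finrank_map_of_injOn hinj.injOn]; omega
  · rintro _ ⟨v, hv, rfl⟩
    rw [hU, one_div, le_inv_mul_iff₀ hpos]
    exact hVA v hv

end LinearMap

end

/-! ### Left inverses with prescribed singular values -/

section

open Module Polynomial InnerProductSpace

variable {𝕜 : Type*} [RCLike 𝕜]
  {E : Type*} [NormedAddCommGroup E] [InnerProductSpace 𝕜 E] [FiniteDimensional 𝕜 E]
  {F : Type*} [NormedAddCommGroup F] [InnerProductSpace 𝕜 F] [FiniteDimensional 𝕜 F]

/-- The inverse of `adjoint A ∘ A`, for injective `A`, has the eigenvalues `(σ i)⁻²`. -/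
theorem LinearMap.exists_inverse_adjoint_comp_self {A : F →ₗ[𝕜] E} (hA : Function.Injective A)
    {n : ℕ} (hn : finrank 𝕜 F = n) {μ : ℕ → ℝ}
    (hμ : ∀ i < n, μ i = (1 / A.singularValues (n - 1 - i)) ^ 2) :
    ∃ R : F →ₗ[𝕜] F, R.IsSymmetric ∧ (∀ x, adjoint A (A (R x)) = x) ∧
      R.charpoly = ∏ i ∈ Finset.range n, (X - C (μ i : 𝕜)) := by
  have hS := A.isSymmetric_adjoint_comp_self
  let e := LinearEquiv.ofInjectiveEndo (adjoint A ∘ₗ A) (A.adjoint_comp_self_injective_iff.2 hA)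
  have he : ∀ x, adjoint A (A (e.symm x)) = x := fun x => e.apply_symm_apply x
  refine ⟨e.symm, fun x y => ?_, he, ?_⟩
  · calc inner 𝕜 (e.symm x) y = inner 𝕜 (e.symm x) ((adjoint A ∘ₗ A) (e.symm y)) := by
          rw [comp_apply, he]
      _ = inner 𝕜 ((adjoint A ∘ₗ A) (e.symm x)) (e.symm y) := (hS _ _).symm
      _ = inner 𝕜 x (e.symm y) := by rw [comp_apply, he]
  · let b := hS.eigenvectorBasis hn
    have hb : ∀ i : Fin n, e.symm (b i) = (((1 / A.singularValues i) ^ 2 : ℝ) : 𝕜) • b i := by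
      intro i
      have hpos := A.injective_iff_forall_lt_finrank_singularValues_pos.1 hA i (hn ▸ i.2)
      have h : e (b i) = ((A.singularValues i ^ 2 : ℝ) : 𝕜) • b i := by
        rw [A.sq_singularValues_fin hn]; exact hS.apply_eigenvectorBasis hn i
      rw [LinearEquiv.symm_apply_eq, map_smul, h, smul_smul, ← RCLike.ofReal_mul, ← mul_pow,
        one_div_mul_cancel hpos.ne']
      simp
    have hM : LinearMap.toMatrix b.toBasis b.toBasis (e.symm : F →ₗ[𝕜] F) =
        Matrix.diagonal fun i : Fin n => (((1 / A.singularValues i) ^ 2 : ℝ) : 𝕜) := by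
      ext i j
      rw [LinearMap.toMatrix_apply, OrthonormalBasis.coe_toBasis, LinearEquiv.coe_coe, hb,
        OrthonormalBasis.coe_toBasis_repr_apply, OrthonormalBasis.repr_apply_apply,
        inner_smul_right, orthonormal_iff_ite.1 b.orthonormal i j, Matrix.diagonal_apply]
      split_ifs with hij <;> simp [hij]
    -- Inversion reverses the order of the eigenvalues, hence the reflected product.
    rw [← LinearMap.charpoly_toMatrix _ b.toBasis, hM, Matrix.charpoly_diagonal,
      Fin.prod_univ_eq_prod_range
        (fun i => X - C (((1 / A.singularValues i) ^ 2 : ℝ) : 𝕜)), ← Finset.prod_range_reflect]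
    exact Finset.prod_congr rfl fun i hi => by rw [hμ i (Finset.mem_range.1 hi)]

/-- Left inverses of an injective map realize all singular values that are allowed by the
interlacing inequalities. -/
theorem LinearMap.exists_leftInverse_singularValues {A : F →ₗ[𝕜] E} (hA : Function.Injective A)
    {n r : ℕ} (hn : finrank 𝕜 F = n) (hr : finrank 𝕜 E = n + r) {μ l : ℕ → ℝ}
    (hμ : ∀ i < n, μ i = (1 / A.singularValues (n - 1 - i)) ^ 2)
    (hμa : Antitone μ) (hl : Antitone l) (h1 : ∀ i, μ i ≤ l i) (h2 : ∀ i, l (i + r) ≤ μ i) :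
    ∃ U : E →ₗ[𝕜] F, U ∘ₗ A = LinearMap.id ∧ ∀ i < n, U.singularValues i = √(l i) := by
  obtain ⟨R, hR, hAR, hRμ⟩ := exists_inverse_adjoint_comp_self hA hn hμ
  obtain ⟨x, hx⟩ := IsSymmetric.exists_charpoly_add_sum_rankOne hn r hR hμa hl h1 h2 hRμ
  have hdim : finrank 𝕜 (A.rangeᗮ : Submodule 𝕜 E) = r := by
    have := A.range.finrank_add_finrank_orthogonal
    rw [finrank_range_of_inj hA] at this
    omega
  let e : OrthonormalBasis (Fin r) 𝕜 (A.rangeᗮ : Submodule 𝕜 E) :=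
    (stdOrthonormalBasis 𝕜 _).reindex (finCongr hdim)
  -- The second summand is orthogonal to `range A`: it does not affect `A* B = id` and adds `∑ j, x
  -- j ⊗ x j` to `B* B`.
  let B : F →ₗ[𝕜] E := A ∘ₗ R + ∑ j, (rankOne 𝕜 (e j : E) (x j)).toLinearMap
  have hB : ∀ y, B y = A (R y) + ((∑ j, inner 𝕜 (x j) y • e j : A.rangeᗮ) : E) := fun y => by
    simp [B]
  have horth : ∀ (y : F) (z : A.rangeᗮ), inner 𝕜 (A y) (z : E) = 0 := fun y z =>
    Submodule.inner_right_of_mem_orthogonal (mem_range_self A y) z.2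
  have horth' : ∀ (y : F) (z : A.rangeᗮ), inner 𝕜 (z : E) (A y) = 0 := fun y z =>
    Submodule.inner_left_of_mem_orthogonal (mem_range_self A y) z.2
  have hBB : adjoint B ∘ₗ B = R + ∑ j, (rankOne 𝕜 (x j) (x j)).toLinearMap := by
    refine LinearMap.ext fun y => ext_inner_left 𝕜 fun z => ?_
    rw [comp_apply, adjoint_inner_right, hB, hB, inner_add_left, inner_add_right, inner_add_right,
      horth, horth', ← Submodule.coe_inner, ← adjoint_inner_right, hAR, hR z y,
      e.orthonormal.inner_sum]
    simp [inner_add_right, inner_sum, inner_smul_right, mul_comm]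
  refine ⟨adjoint B, LinearMap.ext fun y => ext_inner_left 𝕜 fun z => ?_, fun i hi => ?_⟩
  · rw [comp_apply, adjoint_inner_right, hB, inner_add_left, horth', add_zero,
      ← adjoint_inner_left, hAR, id_apply]
  · rw [singularValues_adjoint, B.singularValues_of_lt hn hi,
      IsSymmetric.eigenvalues_eq_of_charpoly _ hn hl (hBB ▸ hx)]

end

/-! ### Frames and their synthesis operators -/

section

variable {𝕜 : Type*} [RCLike 𝕜] {H : Type*} [NormedAddCommGroup H] [InnerProductSpace 𝕜 H] {m : ℕ}

open LinearMap

theorem synthesisOperator_apply (φ : Fin m → H) (c : EuclideanSpace 𝕜 (Fin m)) :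
    synthesisOperator 𝕜 φ c = ∑ i, c i • φ i := rfl

theorem synthesisOperator_single (φ : Fin m → H) (i : Fin m) :
    synthesisOperator 𝕜 φ (EuclideanSpace.single i 1) = φ i := by
  simp [synthesisOperator_apply]

theorem synthesisOperator_apply_single (U : EuclideanSpace 𝕜 (Fin m) →ₗ[𝕜] H) :
    synthesisOperator 𝕜 (fun i => U (EuclideanSpace.single i 1)) = U := by
  refine (EuclideanSpace.basisFun (Fin m) 𝕜).toBasis.ext fun i => ?_
  simp [synthesisOperator_single]

variable [FiniteDimensional 𝕜 H]

theorem adjoint_synthesisOperator_apply (φ : Fin m → H) (x : H) (i : Fin m) :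
    adjoint (synthesisOperator 𝕜 φ) x i = inner 𝕜 (φ i) x := by
  have h := adjoint_inner_right (synthesisOperator 𝕜 φ) (EuclideanSpace.single i 1) x
  rwa [synthesisOperator_single, EuclideanSpace.inner_single_left, map_one, one_mul] at h

theorem norm_sq_adjoint_synthesisOperator (φ : Fin m → H) (x : H) :
    ‖adjoint (synthesisOperator 𝕜 φ) x‖ ^ 2 = ∑ i, ‖inner 𝕜 (φ i) x‖ ^ 2 := by
  simp [EuclideanSpace.norm_sq_eq, adjoint_synthesisOperator_apply]

theorem IsFrame.adjoint_synthesisOperator_injective {φ : Fin m → H} (hφ : IsFrame 𝕜 φ) :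
    Function.Injective (adjoint (synthesisOperator 𝕜 φ)) := by
  obtain ⟨A, B, hA, -, h⟩ := hφ
  refine (injective_iff_map_eq_zero _).2 fun x hx => ?_
  have h1 := (h x).1
  rw [← norm_sq_adjoint_synthesisOperator, hx, norm_zero, zero_pow two_ne_zero] at h1
  have := nonpos_of_mul_nonpos_right h1 hA
  exact norm_eq_zero.1 (pow_eq_zero_iff two_ne_zero |>.1 (le_antisymm this (sq_nonneg _)))

/-- In finite dimension an injective map is bounded below, and the operator norm gives the upper
bound. -/
theorem isFrame_of_adjoint_synthesisOperator_injective {φ : Fin m → H}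
    (hφ : Function.Injective (adjoint (synthesisOperator 𝕜 φ))) : IsFrame 𝕜 φ := by
  obtain ⟨K, hK, hanti⟩ := (adjoint (synthesisOperator 𝕜 φ)).injective_iff_antilipschitz.1 hφ
  set T := (adjoint (synthesisOperator 𝕜 φ)).toContinuousLinearMap with hT
  have hlow : ∀ x : H, ((K : ℝ) ^ 2)⁻¹ * ‖x‖ ^ 2 ≤ ‖adjoint (synthesisOperator 𝕜 φ) x‖ ^ 2 := by
    intro x
    have hK' : (0 : ℝ) < K := hK
    rw [inv_mul_le_iff₀ (by positivity), ← mul_pow]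
    exact pow_le_pow_left₀ (norm_nonneg _) (hanti.le_mul_norm (map_zero _) x) 2
  have hup : ∀ x : H, ‖adjoint (synthesisOperator 𝕜 φ) x‖ ^ 2 ≤ ‖T‖ ^ 2 * ‖x‖ ^ 2 := by
    intro x
    rw [← mul_pow]
    exact pow_le_pow_left₀ (norm_nonneg _) (T.le_opNorm x) 2
  have hK' : (0 : ℝ) < K := hK
  -- The maximum secures `A ≤ B` even when `H` is trivial and `‖T‖ = 0`.
  refine ⟨((K : ℝ) ^ 2)⁻¹, max (((K : ℝ) ^ 2)⁻¹) (‖T‖ ^ 2), by positivity, le_max_left _ _,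
    fun x => ?_⟩
  rw [← norm_sq_adjoint_synthesisOperator]
  exact ⟨hlow x, (hup x).trans (by gcongr; exact le_max_right _ _)⟩

theorem isDualFrame_iff {φ ψ : Fin m → H} :
    IsDualFrame 𝕜 φ ψ ↔ IsFrame 𝕜 ψ ∧
      synthesisOperator 𝕜 ψ ∘ₗ adjoint (synthesisOperator 𝕜 φ) = LinearMap.id := by
  have h : ∀ x, synthesisOperator 𝕜 ψ (adjoint (synthesisOperator 𝕜 φ) x) =
      ∑ i, inner 𝕜 (φ i) x • ψ i := fun x => by
    simp_rw [synthesisOperator_apply, adjoint_synthesisOperator_apply]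
  simp only [IsDualFrame, LinearMap.ext_iff, comp_apply, id_apply, h, eq_comm]

end

/-! ### Singular values of dual frames -/

theorem mainTheorem1 {𝕜 : Type*} [RCLike 𝕜] (n m r : ℕ) (hr : r = m - n)
    (Φ : Fin m → EuclideanSpace 𝕜 (Fin n)) (hΦ : IsFrame 𝕜 Φ) :
    (∀ Ψ : Fin m → EuclideanSpace 𝕜 (Fin n), IsDualFrame 𝕜 Φ Ψ →
      (∀ i : ℕ, 1 ≤ i → i ≤ n → i ≤ r →
        1 / frameSingularValue 𝕜 Φ (n - i + 1) ≤ frameSingularValue 𝕜 Ψ i) ∧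
      (∀ i : ℕ, r + 1 ≤ i → i ≤ n →
        1 / frameSingularValue 𝕜 Φ (n - i + 1) ≤ frameSingularValue 𝕜 Ψ i ∧
        frameSingularValue 𝕜 Ψ i ≤ 1 / frameSingularValue 𝕜 Φ (n - i + r + 1))) ∧
    (∀ s : ℕ → ℝ, AntitoneOn s (Set.Icc 1 n) →
      (∀ i : ℕ, 1 ≤ i → i ≤ n → i ≤ r →
        1 / frameSingularValue 𝕜 Φ (n - i + 1) ≤ s i) →
      (∀ i : ℕ, r + 1 ≤ i → i ≤ n →
        1 / frameSingularValue 𝕜 Φ (n - i + 1) ≤ s i ∧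
        s i ≤ 1 / frameSingularValue 𝕜 Φ (n - i + r + 1)) →
      ∃ Ψ : Fin m → EuclideanSpace 𝕜 (Fin n), IsDualFrame 𝕜 Φ Ψ ∧
        ∀ i : ℕ, 1 ≤ i → i ≤ n → frameSingularValue 𝕜 Ψ i = s i) := by
  set A := LinearMap.adjoint (synthesisOperator 𝕜 Φ) with hA
  have hinj : Function.Injective A := hΦ.adjoint_synthesisOperator_injective
  have hF : Module.finrank 𝕜 (EuclideanSpace 𝕜 (Fin n)) = n := finrank_euclideanSpace_fin
  -- Injectivity of `A` gives `n ≤ m`, so the subtraction in `r = m - n` is not truncated.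
  have hE : Module.finrank 𝕜 (EuclideanSpace 𝕜 (Fin m)) = n + r := by
    have := LinearMap.finrank_le_finrank_of_injective hinj
    rw [finrank_euclideanSpace_fin, finrank_euclideanSpace_fin] at this
    rw [finrank_euclideanSpace_fin]
    omega
  have hσ : ∀ k, frameSingularValue 𝕜 Φ (k + 1) = A.singularValues k := fun k =>
    ((synthesisOperator 𝕜 Φ).singularValues_adjoint k).symm
  have hpos : ∀ k < n, 0 < A.singularValues k := fun k hk =>
    A.injective_iff_forall_lt_finrank_singularValues_pos.1 hinj k (hF.symm ▸ hk)
  refine ⟨fun Ψ hΨ => ?_, fun s hs h1 h2 => ?_⟩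
  · have hid := (isDualFrame_iff.1 hΨ).2
    have hlow : ∀ i : ℕ, 1 ≤ i → i ≤ n →
        1 / frameSingularValue 𝕜 Φ (n - i + 1) ≤ frameSingularValue 𝕜 Ψ i := fun i hi hin => by
      have := LinearMap.inv_singularValues_le_of_comp_eq_id hid (k := i - 1) (by omega)
      rw [hF, show n - 1 - (i - 1) = n - i by omega] at this
      rwa [hσ]
    refine ⟨fun i hi hin _ => hlow i hi hin, fun i hi hin => ⟨hlow i (by omega) hin, ?_⟩⟩
    have := LinearMap.singularValues_le_inv_of_comp_eq_id hid (r := r) (k := i - 1) (by rw [hE, hF])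
      (by omega) (by omega)
    rw [hF, show n - 1 - (i - 1) = n - i by omega] at this
    rwa [hσ]
  · have hlow : ∀ i < n, 1 / A.singularValues (n - 1 - i) ≤ s (i + 1) := fun i hi => by
      have e : n - (i + 1) = n - 1 - i := by omega
      rw [← hσ, ← e]
      rcases le_or_gt (i + 1) r with h | h
      · exact h1 (i + 1) (by omega) hi h
      · exact (h2 (i + 1) (by omega) hi).1
    have hσ0 : ∀ i, 0 ≤ 1 / A.singularValues i := fun i =>
      one_div_nonneg.2 (A.singularValues_nonneg i)
    have hs0 : ∀ i < n, 0 ≤ s (i + 1) := fun i hi => (hσ0 _).trans (hlow i hi)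
    -- Squares turn singular values into eigenvalues. Extension by zero beyond `n` makes
    -- monotonicity and interlacing hold at all indices, including `i < n ≤ i + r`.
    let μ : ℕ → ℝ := fun i => if i < n then (1 / A.singularValues (n - 1 - i)) ^ 2 else 0
    let l : ℕ → ℝ := fun i => if i < n then s (i + 1) ^ 2 else 0
    have hμa : Antitone μ := fun i j hij => by
      dsimp only [μ, l]
      split_ifs with hj hi hi
      · have := hpos (n - 1 - i) (by omega)
        exact pow_le_pow_left₀ (hσ0 _) (one_div_le_one_div_of_le this
          (A.singularValues_antitone (by omega))) 2
      · omega
      · positivity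
      · exact le_rfl
    have hla : Antitone l := fun i j hij => by
      dsimp only [μ, l]
      split_ifs with hj hi hi
      · exact pow_le_pow_left₀ (hs0 j hj) (hs ⟨by omega, by omega⟩ ⟨by omega, by omega⟩
          (by omega)) 2
      · omega
      · positivity
      · exact le_rfl
    have hμl : ∀ i, μ i ≤ l i := fun i => by
      dsimp only [μ, l]
      split_ifs with hi
      · exact pow_le_pow_left₀ (hσ0 _) (hlow i hi) 2
      · exact le_rfl
    have hlμ : ∀ i, l (i + r) ≤ μ i := fun i => by
      dsimp only [μ, l]
      split_ifs with hir hi hi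
      · have := (h2 (i + r + 1) (by omega) hir).2
        rw [hσ, show n - (i + r + 1) + r = n - 1 - i by omega] at this
        exact pow_le_pow_left₀ (hs0 _ hir) this 2
      · omega
      · positivity
      · exact le_rfl
    obtain ⟨U, hU, hUs⟩ := LinearMap.exists_leftInverse_singularValues hinj hF hE
      (fun i hi => if_pos hi) hμa hla hμl hlμ
    have hΨ := synthesisOperator_apply_single U
    refine ⟨fun i => U (EuclideanSpace.single i 1), isDualFrame_iff.2 ⟨?_, by rw [hΨ]; exact hU⟩,
      fun i hi hin => ?_⟩
    · refine isFrame_of_adjoint_synthesisOperator_injective ?_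
      rw [hΨ]
      -- Taking adjoints in `U A = id` shows that `U*` is injective, so Ψ is a frame.
      have hUA : LinearMap.adjoint A ∘ₗ LinearMap.adjoint U = LinearMap.id := by
        rw [← LinearMap.adjoint_comp, hU, LinearMap.adjoint_id]
      exact Function.LeftInverse.injective (g := LinearMap.adjoint A) (LinearMap.congr_fun hUA)
    · rw [frameSingularValue, hΨ, hUs (i - 1) (by omega), show l (i - 1) = _ from if_pos (by omega),
        Real.sqrt_sq (hs0 _ (by omega)), Nat.sub_add_cancel hi]
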